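/- Fix an integer $d\ge 0$. A system $X=(X,\mathcal A,\mu,T_1,\dots,T_d)$ is a standard Borel probability space with $d$ pairwise commuting invertible bimeasurable measure-preserving transformations. A factor map $p:X\to Y$ is a measurable map with $p_*\mu=\nu$ and $p\circ T_i=S_i\circ p$ almost everywhere for all $i$; then $Y$ is a factor of $X$ and $X$ an extension of $Y$, and the corresponding factor $\sigma$-algebra of $X$ is the $\sigma$-algebra of measurable sets equal modulo $\mu$ to some $p^{-1}(B)$, $B$ measurable. Isomorphisms are understood modulo null sets. A joining of a countable family of systems is a probability measure on the product space with the given marginals, invariant under the product transformations; it defines a system. For a class $\mathscr C$ of systems, a $\mathscr C$-factor of $X$ is a factor $\sigma$-algebra on which the action of the transformations defines a system of $\mathscr C$, and the largest $\mathscr C$-factor $X_{\mathscr C}$, when it exists, is the one that contains all the others. A joining $\lambda$ of $X$ and $Y$ is relatively independent over a factor $\sigma$-algebra $\mathcal F$ of $X$ if $\mathbb E_\lambda[f(x)\mid Y]=\mathbb E_\lambda\bigl[\mathbb E_\mu[f\mid\mathcal F](x)\mid Y\bigr]$ for every bounded measurable $f$ on $X$. The relatively independent joining of $X$ and $Y$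 over a common factor $F$ (with factor maps $p:X\to F$, $q:Y\to F$) is the joining for which $p(x)=q(y)$ almost surely and which is relatively independent over the factor $\sigma$-algebra of $X$ given by $p$. The system $X$ is $\mathscr C$-sated if it has a largest $\mathscr C$-factor and every joining of $X$ with a system of $\mathscr C$ is relatively independent over it. Let $\overline{\mathscr C}$ be the class of all factors of systems of $\mathscr C$. Theorem. Let $\mathscr C$ be a nonempty class of systems that is stable under isomorphism and under joinings of nonempty countable families. Then every system $X$ has a $\mathscr C$-sated extension. More precisely, $X$ has a largest $\overline{\mathscr C}$-factor $X_{\overline{\mathscr C}}$; as a system, $X_{\overline{\mathscr C}}$ has an extension in $\mathscr C$; and for every extension $Y\in\mathscr C$ of $X_{\overline{\mathscr C}}$, the relatively independent joining of $X$ and $Y$ over $X_{\overline{\mathscr C}}$ exists and is a $\mathscr C$-sated extension of $X$. -/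

import Mathlib

open MeasureTheory ProbabilityTheory

universe u

/-- A system: `d` pairwise commuting invertible measure-preserving transformations of a standard
Borel probability space. -/
structure MPSystem (d : ℕ) where
  carrier : Type u
  [measurableSpace : MeasurableSpace carrier]
  [standardBorel : StandardBorelSpace carrier]
  μ : Measure carrier
  [isProb : IsProbabilityMeasure μ]
  T : Fin d → carrier ≃ᵐ carrier
  measurePreserving : ∀ i, MeasurePreserving (T i) μ μ
  comm : ∀ i j x, T i (T j x) = T j (T i x)

namespace MPSystem

variable {d : ℕ}

instance : CoeSort (MPSystem.{u} d) (Type u) := ⟨MPSystem.carrier⟩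

attribute [instance] measurableSpace standardBorel isProb

/-- `p : X → Y` is a factor map, that is, `Y` is a factor of `X` and `X` is an extension of `Y`
through `p`. Equivariance is required almost everywhere. -/
structure IsFactorMap (X Y : MPSystem.{u} d) (p : X → Y) : Prop where
  measurePreserving : MeasurePreserving p X.μ Y.μ
  equivariant : ∀ i, ∀ᵐ x ∂X.μ, p (X.T i x) = Y.T i (p x)

/-- Isomorphism of systems, modulo null sets. -/
def Isomorphic (X Y : MPSystem.{u} d) : Prop :=
  ∃ (φ : X → Y) (ψ : Y → X), IsFactorMap X Y φ ∧ IsFactorMap Y X ψ ∧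
    (∀ᵐ x ∂X.μ, ψ (φ x) = x) ∧ (∀ᵐ y ∂Y.μ, φ (ψ y) = y)

/-- The factor sub-σ-algebra of `X` defined by a map `p : X → Y`: the measurable sets which
coincide, modulo a null set, with the preimage under `p` of some measurable set. -/
@[reducible] def factorAlgebra (X Y : MPSystem.{u} d) (p : X → Y) : MeasurableSpace X where
  MeasurableSet' A := MeasurableSet A ∧ ∃ B : Set Y, MeasurableSet B ∧ A =ᵐ[X.μ] p ⁻¹' B
  measurableSet_empty := ⟨MeasurableSet.empty, ∅, MeasurableSet.empty, by simp⟩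
  measurableSet_compl := by
    rintro A ⟨hA, B, hB, h⟩
    exact ⟨hA.compl, Bᶜ, hB.compl, by simpa using h.compl⟩
  measurableSet_iUnion := by
    intro A hA
    choose hm B hB h using hA
    refine ⟨MeasurableSet.iUnion hm, ⋃ n, B n, MeasurableSet.iUnion hB, ?_⟩
    rw [Set.preimage_iUnion]
    exact Filter.EventuallyEq.countable_iUnion h

/-- `m` is a `C`-factor of `X`: a factor sub-σ-algebra on which the action of the transformations
defines (in a standard Borel model) a system of the class `C`. -/
def IsClassFactor (C : Set (MPSystem.{u} d)) (X : MPSystem.{u} d) (m : MeasurableSpace X) : Prop :=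
  ∃ Y ∈ C, ∃ p : X → Y, IsFactorMap X Y p ∧ m = factorAlgebra X Y p

/-- `m` is the largest `C`-factor of `X`, for the inclusion of σ-algebras. -/
def IsLargestClassFactor (C : Set (MPSystem.{u} d)) (X : MPSystem.{u} d)
    (m : MeasurableSpace X) : Prop :=
  IsGreatest {m' | IsClassFactor C X m'} m

/-- The class of all factors of `C`-systems. -/
def factorClass (C : Set (MPSystem.{u} d)) : Set (MPSystem.{u} d) :=
  {W | ∃ Y ∈ C, ∃ q : Y → W, IsFactorMap Y W q}

/-- A joining of two systems: a probability measure on the product space with the given marginals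
which is invariant under the product transformations. -/
structure Joining (X Y : MPSystem.{u} d) where
  measure : Measure (X × Y)
  [isProb : IsProbabilityMeasure measure]
  fst : MeasurePreserving Prod.fst measure X.μ
  snd : MeasurePreserving Prod.snd measure Y.μ
  invariant : ∀ i, MeasurePreserving ((X.T i).prodCongr (Y.T i)) measure measure

attribute [instance] Joining.isProb

/-- The system on the product space defined by a joining. -/
def Joining.toSystem {X Y : MPSystem.{u} d} (lam : Joining X Y) : MPSystem.{u} d where
  carrier := X × Y
  μ := lam.measure
  T i := (X.T i).prodCongr (Y.T i)
  measurePreserving := lam.invariant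
  comm i j z := Prod.ext (X.comm i j z.1) (Y.comm i j z.2)

/-- A joining of a family of systems. -/
structure FamilyJoining {ι : Type} (X : ι → MPSystem.{u} d) where
  measure : Measure (∀ k, X k)
  [isProb : IsProbabilityMeasure measure]
  eval : ∀ k, MeasurePreserving (fun x : ∀ k, X k => x k) measure (X k).μ
  invariant : ∀ i, MeasurePreserving (MeasurableEquiv.piCongrRight fun k => (X k).T i)
    measure measure

attribute [instance] FamilyJoining.isProb

/-- The system on the product space defined by a joining of a countable family. -/
def FamilyJoining.toSystem {ι : Type} [Countable ι] {X : ι → MPSystem.{u} d}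
    (lam : FamilyJoining X) : MPSystem.{u} d where
  carrier := ∀ k, X k
  μ := lam.measure
  T i := MeasurableEquiv.piCongrRight fun k => (X k).T i
  measurePreserving := lam.invariant
  comm i j z := funext fun k => (X k).comm i j (z k)

def StableUnderIsomorphism (C : Set (MPSystem.{u} d)) : Prop :=
  ∀ X Y : MPSystem.{u} d, Isomorphic X Y → X ∈ C → Y ∈ C

/-- Stability under joinings of nonempty (finite or infinite) countable families. -/
def StableUnderCountableJoinings (C : Set (MPSystem.{u} d)) : Prop :=
  ∀ (ι : Type) [Countable ι] [Nonempty ι] (X : ι → MPSystem.{u} d), (∀ k, X k ∈ C) →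
    ∀ lam : FamilyJoining X, lam.toSystem ∈ C

/-- The joining `lam` of `X` and `Y` is relatively independent over the sub-σ-algebra `m` of `X`:
`E[f(x) | Y] = E[E[f | m](x) | Y]` in `lam` for every bounded measurable function `f` on `X`. -/
def Joining.IsRelIndepOver {X Y : MPSystem.{u} d} (lam : Joining X Y) (m : MeasurableSpace X) :
    Prop :=
  ∀ f : X → ℝ, Measurable[X.measurableSpace] f → (∃ c, ∀ x, |f x| ≤ c) →
    lam.measure[fun z => f z.1 | Y.measurableSpace.comap Prod.snd] =ᵐ[lam.measure]
      lam.measure[fun z => (X.μ[f | m]) z.1 | Y.measurableSpace.comap Prod.snd]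

/-- `lam` is the relatively independent joining of `X` and `Y` over their common factor `F`, for
the factor maps `p : X → F` and `q : Y → F`: the two copies of `F` are identified in `lam`, and
`X` and `Y` are relatively independent over it. -/
def Joining.IsRelIndepJoining {X Y : MPSystem.{u} d} (lam : Joining X Y) (F : MPSystem.{u} d)
    (p : X → F) (q : Y → F) : Prop :=
  (∀ᵐ z ∂lam.measure, p z.1 = q z.2) ∧ lam.IsRelIndepOver (factorAlgebra X F p)

/-- `X` is `C`-sated: it has a largest `C`-factor, and each of its joinings with a `C`-system is
relatively independent over this factor. -/
def IsSated (C : Set (MPSystem.{u} d)) (X : MPSystem.{u} d) : Prop :=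
  ∃ m : MeasurableSpace X, IsLargestClassFactor C X m ∧
    ∀ Y ∈ C, ∀ lam : Joining X Y, lam.IsRelIndepOver m

end MPSystem

/-! Joinings of `X` with `W` correspond to equivariant Markov kernels from `X` to `W`, and such a
joining is relatively independent over any sub-σ-algebra for which the kernel is measurable
(`Joining.isRelIndepOver_of_kernel`). Everything reduces to measurability of kernels.

Let `W ∈ C` and let `κ` be the kernel of a joining. Taking infinitely many copies of `W`,
conditionally independent over `X`, gives a joining of `X` with a system on `ℕ → W` that is again in
`C`. By the strong law of large numbers `κ x B` is a function of the sequence of copies. It is thus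
a function both on `X` and on a `C`-system, and its values along orbits generate a common factor
(`exists_factor_of_ae_eq`). So `κ` is measurable for the largest `factorClass C`-factor `F`, which
exists by separability of `L¹`.

Now let `Y ∈ C` extend `F` and let `Z` be the relatively independent joining of `X` and `Y` over
`F`. For a joining of `Z` with `V ∈ C`, the pair `(Y, V)` is itself a `C`-system, so `X` is
independent of it relatively to `F`, a factor that `Y` already determines. Hence the kernel from `Z`
to `V` is `Y`-measurable (`Joining.IsRelIndepJoining.aestronglyMeasurable_kernel`). Applied to
arbitrary kernels this is relative independence over `Y`; applied to deterministic ones it says that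
`Y` is the largest `C`-factor of `Z`. -/

namespace ProbabilityTheory.Kernel

/-! ### Products of Markov kernels -/

variable {α : Type*} {ι : Type*} {β : ι → Type*} [MeasurableSpace α] [∀ k, MeasurableSpace (β k)]

/-- The product of a family of Markov kernels with the same source. -/
noncomputable def infinitePi (κ : ∀ k, Kernel α (β k)) [∀ k, IsMarkovKernel (κ k)] :
    Kernel α (∀ k, β k) where
  toFun a := Measure.infinitePi fun k => κ k a
  measurable' := by
    refine Measurable.measure_of_isPiSystem_of_isProbabilityMeasure
      generateFrom_squareCylinders.symm
      (isPiSystem_squareCylinders (fun _ => MeasurableSpace.isPiSystem_measurableSet)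
        fun _ => MeasurableSet.univ) ?_
    rintro _ ⟨s, t, ht, rfl⟩
    have ht' : ∀ k, MeasurableSet (t k) := fun k => ht k trivial
    simp_rw [Measure.infinitePi_pi _ fun k _ => ht' k]
    exact Finset.measurable_fun_prod _ fun k _ => (κ k).measurable_coe (ht' k)

theorem infinitePi_apply (κ : ∀ k, Kernel α (β k)) [∀ k, IsMarkovKernel (κ k)] (a : α) :
    infinitePi κ a = Measure.infinitePi fun k => κ k a := rfl

instance (κ : ∀ k, Kernel α (β k)) [∀ k, IsMarkovKernel (κ k)] :
    IsMarkovKernel (infinitePi κ) :=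
  ⟨fun a => by rw [infinitePi_apply]; infer_instance⟩

end ProbabilityTheory.Kernel

/-! ### Disintegrations and invariance -/

namespace MeasureTheory

/-- A transformation which is the image of a measure-preserving one under `φ` preserves the image
measure. -/
theorem MeasurePreserving.of_ae_semiconj {α β : Type*} [MeasurableSpace α] [MeasurableSpace β]
    {μ : Measure α} {ν : Measure β} {φ : α → β} {S : α → α} {T : β → β}
    (hφ : MeasurePreserving φ μ ν) (hS : MeasurePreserving S μ μ) (hT : Measurable T)
    (h : ∀ᵐ a ∂μ, φ (S a) = T (φ a)) : MeasurePreserving T ν ν := by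
  refine ⟨hT, ?_⟩
  have h' : φ ∘ S =ᵐ[μ] T ∘ φ := h
  rw [← hφ.map_eq, Measure.map_map hT hφ.measurable, ← Measure.map_congr h',
    ← Measure.map_map hφ.measurable hS.measurable, hS.map_eq]

variable {α α' β β' : Type*} [MeasurableSpace α] [MeasurableSpace α'] [MeasurableSpace β]
  [MeasurableSpace β']

theorem Measure.measurePreserving_prodMap_compProd {μ : Measure α} {μ' : Measure α'}
    [SFinite μ] [SFinite μ'] {κ : Kernel α β} {κ' : Kernel α' β'} [IsSFiniteKernel κ]
    [IsSFiniteKernel κ'] {φ : α → α'} {S : β → β'} (hφ : MeasurePreserving φ μ μ')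
    (hS : Measurable S) (h : ∀ᵐ a ∂μ, κ' (φ a) = (κ a).map S) :
    MeasurePreserving (Prod.map φ S) (μ ⊗ₘ κ) (μ' ⊗ₘ κ') := by
  refine ⟨hφ.measurable.prodMap hS, Measure.ext fun s hs => ?_⟩
  have hm : Measurable fun a => κ' a (Prod.mk a ⁻¹' s) := Kernel.measurable_kernel_prodMk_left hs
  rw [Measure.map_apply (hφ.measurable.prodMap hS) hs, Measure.compProd_apply hs,
    Measure.compProd_apply (hφ.measurable.prodMap hS hs), ← hφ.lintegral_comp hm]
  refine lintegral_congr_ae ?_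
  filter_upwards [h] with a ha
  rw [ha, Measure.map_apply hS (measurable_prodMk_left hs)]
  rfl

/-- Uniqueness of disintegration: transporting the conditional measures of an invariant measure by
the transformation gives conditional measures of the same measure. -/
theorem Measure.ae_condKernel_map [StandardBorelSpace β] [Nonempty β] {ρ : Measure (α × β)}
    [IsFiniteMeasure ρ] (T : α ≃ᵐ α) (S : β → β) (hS : Measurable S)
    (h : MeasurePreserving (Prod.map T S) ρ ρ) :
    ∀ᵐ a ∂ρ.fst, ρ.condKernel (T a) = (ρ.condKernel a).map S := by
  have hfst : MeasurePreserving Prod.fst ρ ρ.fst := ⟨measurable_fst, rfl⟩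
  have hT : MeasurePreserving T ρ.fst ρ.fst :=
    hfst.of_ae_semiconj h T.measurable (Filter.Eventually.of_forall fun _ => rfl)
  -- The transported kernel, whose value at `T a` is the image under `S` of the conditional measure
  -- at `a`; invertibility of `T` is what makes it well defined.
  let κ' : Kernel α β := (ρ.condKernel.map S).comap T.symm T.symm.measurable
  have hκ' : ∀ a, κ' (T a) = (ρ.condKernel a).map S := fun a => by
    simp [κ', Kernel.comap_apply, Kernel.map_apply _ hS]
  have : IsMarkovKernel (ρ.condKernel.map S) := Kernel.IsMarkovKernel.map _ hS
  have h1 := Measure.measurePreserving_prodMap_compProd (κ := ρ.condKernel) (κ' := κ') hT hS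
    (Filter.Eventually.of_forall hκ')
  have h2 : ρ = ρ.fst ⊗ₘ κ' := by
    rw [← h1.map_eq, Measure.disintegrate, h.map_eq]
  have h3 := eq_condKernel_of_measure_eq_compProd κ' h2
  filter_upwards [hT.quasiMeasurePreserving.ae h3] with a ha
  rw [← ha, hκ']

/-- Two integrable functions on a product which have the same integrals on measurable rectangles
are equal almost everywhere. -/
theorem ae_eq_of_setIntegral_prod_eq {ρ : Measure (α × β)} {f g : α × β → ℝ}
    (hf : Integrable f ρ) (hg : Integrable g ρ)
    (h : ∀ A B, MeasurableSet A → MeasurableSet B →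
      ∫ z in A ×ˢ B, f z ∂ρ = ∫ z in A ×ˢ B, g z ∂ρ) : f =ᵐ[ρ] g := by
  have huniv : ∫ z, f z ∂ρ = ∫ z, g z ∂ρ := by
    simpa using h Set.univ Set.univ MeasurableSet.univ MeasurableSet.univ
  have key : ∀ s, MeasurableSet s → ∫ z in s, f z ∂ρ = ∫ z in s, g z ∂ρ := by
    intro s hs
    induction s, hs using MeasurableSpace.induction_on_inter generateFrom_prod.symm
      isPiSystem_prod with
    | empty => simp
    | basic t ht =>
      obtain ⟨A, hA, B, hB, rfl⟩ := ht
      exact h A B hA hB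
    | compl t ht ih =>
      have h1 := integral_add_compl ht hf
      have h2 := integral_add_compl ht hg
      linarith
    | iUnion t hd ht ih =>
      rw [integral_iUnion ht hd hf.integrableOn, integral_iUnion ht hd hg.integrableOn]
      exact tsum_congr ih
  exact hf.ae_eq_of_forall_setIntegral_eq f g hg fun s hs _ => key s hs

theorem setIntegral_snd_compProd {μ : Measure α} [SFinite μ] {κ : Kernel α β} [IsFiniteKernel κ]
    {u : α → ℝ} (hu : Integrable (fun z : α × β => u z.1) (μ ⊗ₘ κ)) {B : Set β}
    (hB : MeasurableSet B) :
    ∫ z in Prod.snd ⁻¹' B, u z.1 ∂(μ ⊗ₘ κ) = ∫ a, u a * (κ a).real B ∂μ := by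
  rw [← Set.univ_prod, Measure.setIntegral_compProd MeasurableSet.univ hB hu.integrableOn,
    Measure.restrict_univ]
  refine integral_congr_ae (Filter.Eventually.of_forall fun a => ?_)
  simp [mul_comm]

end MeasureTheory

namespace MeasureTheory

theorem integral_condExp_mul {α : Type*} {m m0 : MeasurableSpace α} {μ : Measure α}
    [IsFiniteMeasure μ] (hm : m ≤ m0) {f h : α → ℝ} (hf : Integrable f μ)
    (hh : AEStronglyMeasurable[m] h μ) (hfh : Integrable (f * h) μ) :
    ∫ x, (μ[f | m]) x * h x ∂μ = ∫ x, f x * h x ∂μ := by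
  rw [← integral_condExp (f := fun x => f x * h x) hm]
  exact integral_congr_ae (condExp_mul_of_aestronglyMeasurable_right hh hfh hf).symm

end MeasureTheory

/-! ### Factor σ-algebras, and relative independence through kernels -/

namespace MPSystem

variable {d : ℕ} {X Y W F : MPSystem.{u} d}

theorem factorAlgebra_le (X Y : MPSystem.{u} d) (p : X → Y) :
    factorAlgebra X Y p ≤ X.measurableSpace := fun _ h => h.1

theorem comap_le_factorAlgebra {p : X → Y} (hp : Measurable p) :
    Y.measurableSpace.comap p ≤ factorAlgebra X Y p := by
  rintro _ ⟨B, hB, rfl⟩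
  exact ⟨hp hB, B, hB, ae_eq_refl _⟩

theorem measurable_factorAlgebra {p : X → Y} (hp : Measurable p) :
    Measurable[factorAlgebra X Y p] p :=
  fun _ hB => comap_le_factorAlgebra hp _ ⟨_, hB, rfl⟩

instance (X : MPSystem.{u} d) : Nonempty X := nonempty_of_isProbabilityMeasure X.μ

/-- A map which is measurable for a factor σ-algebra is almost everywhere a function of the factor
map. -/
theorem exists_ae_eq_comp {E : Type*} [MeasurableSpace E] [StandardBorelSpace E] [Nonempty E]
    {p : X → Y} {g : X → E} (hg : Measurable[factorAlgebra X Y p] g) :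
    ∃ h : Y → E, Measurable h ∧ g =ᵐ[X.μ] h ∘ p := by
  -- Coding `E` by binary sequences reduces the claim to countably many sets, each of which is a
  -- preimage under `p` up to a null set.
  let e : E → ℕ → Bool := MeasurableSpace.mapNatBool E
  have he : Measurable e := MeasurableSpace.measurable_mapNatBool E
  have hem : MeasurableEmbedding e :=
    he.measurableEmbedding (MeasurableSpace.injective_mapNatBool E)
  have hB : ∀ n, ∃ B : Set Y, MeasurableSet B ∧ {x | e (g x) n = true} =ᵐ[X.μ] p ⁻¹' B := by
    intro n
    have : MeasurableSet {b : E | e b n = true} :=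
      ((measurable_pi_apply n).comp he) (MeasurableSet.singleton true)
    exact (hg this).2
  choose B hBm hB using hB
  classical
  let k : Y → ℕ → Bool := fun y n => decide (y ∈ B n)
  have hk : Measurable k := measurable_pi_lambda _ fun n => by
    refine measurable_to_bool ?_
    have : (fun y => k y n) ⁻¹' {true} = B n := by ext y; simp [k]
    rw [this]; exact hBm n
  -- `k y` may lie outside the range of `e`, so a left inverse of `e` defined and measurable on all
  -- sequences is needed.
  obtain ⟨r, hr, hre⟩ := hem.exists_measurable_extend measurable_id fun _ => inferInstance
  refine ⟨r ∘ k, hr.comp hk, ?_⟩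
  filter_upwards [ae_all_iff.2 fun n => (hB n).mem_iff] with x hx
  have : e (g x) = k (p x) := by
    funext n
    have := hx n
    simp only [Set.mem_preimage] at this
    rw [Bool.eq_iff_iff, this]
    simp [k]
  have h2 := congrFun hre (g x)
  simp only [Function.comp_apply, id] at h2 ⊢
  rw [← this, h2]

theorem aestronglyMeasurable_comap_of_factorAlgebra {p : X → Y} {f : X → ℝ}
    (hf : AEStronglyMeasurable[factorAlgebra X Y p] f X.μ) :
    ∃ h : Y → ℝ, Measurable h ∧ f =ᵐ[X.μ] h ∘ p := by
  obtain ⟨f', hf', hff'⟩ := hf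
  obtain ⟨h, hh, hfh⟩ := exists_ae_eq_comp hf'.measurable
  exact ⟨h, hh, hff'.trans hfh⟩

theorem aestronglyMeasurable_factorAlgebra {p : X → Y} (hp : Measurable p) {h : Y → ℝ}
    (hh : Measurable h) {f : X → ℝ} (hf : f =ᵐ[X.μ] h ∘ p) :
    AEStronglyMeasurable[factorAlgebra X Y p] f X.μ :=
  ⟨h ∘ p, (hh.comp (measurable_factorAlgebra hp)).stronglyMeasurable, hf⟩

theorem measurableSet_factorAlgebra_of_aestronglyMeasurable {p : X → Y} {A : Set X}
    (hA : MeasurableSet A)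
    (hf : AEStronglyMeasurable[factorAlgebra X Y p] (A.indicator fun _ => (1 : ℝ)) X.μ) :
    MeasurableSet[factorAlgebra X Y p] A := by
  obtain ⟨h, hh, hfh⟩ := aestronglyMeasurable_comap_of_factorAlgebra hf
  refine ⟨hA, h ⁻¹' {1}, hh (MeasurableSet.singleton 1), ?_⟩
  filter_upwards [hfh] with x hx
  refine propext ?_
  change x ∈ A ↔ h (p x) = 1
  by_cases hxA : x ∈ A
  · simpa [hxA, eq_comm] using hx
  · simp only [hxA, not_false_eq_true, Set.indicator_of_notMem, Function.comp_apply] at hx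
    simp [hxA, ← hx]

/-- The two σ-algebras differ only by null sets: a function measurable for the larger one is almost
everywhere a function of `p`. -/
theorem condExp_factorAlgebra {p : X → Y} (hp : Measurable p) {f : X → ℝ}
    (hf : Integrable f X.μ) :
    X.μ[f | factorAlgebra X Y p] =ᵐ[X.μ] X.μ[f | Y.measurableSpace.comap p] := by
  refine ae_eq_condExp_of_forall_setIntegral_eq hp.comap_le hf
    (fun _ _ _ => integrable_condExp.integrableOn)
    (fun s hs _ => setIntegral_condExp (factorAlgebra_le X Y p) hf
      (comap_le_factorAlgebra hp s hs)) ?_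
  obtain ⟨h, hh, hfh⟩ := aestronglyMeasurable_comap_of_factorAlgebra (X := X) (p := p)
    (f := X.μ[f | factorAlgebra X Y p]) stronglyMeasurable_condExp.aestronglyMeasurable
  exact ⟨h ∘ p, (hh.comp (comap_measurable p)).stronglyMeasurable, hfh⟩

theorem IsFactorMap.comp {p : X → Y} {q : Y → W} (hq : IsFactorMap Y W q)
    (hp : IsFactorMap X Y p) : IsFactorMap X W (q ∘ p) where
  measurePreserving := hq.measurePreserving.comp hp.measurePreserving
  equivariant i := by
    filter_upwards [hp.equivariant i,
      hp.measurePreserving.quasiMeasurePreserving.ae (hq.equivariant i)] with x h1 h2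
    simp only [Function.comp_apply, h1, h2]

/-- A map through which a factor map factorizes is a factor map. -/
theorem IsFactorMap.of_comp {p : X → F} {p' : X → W} {g : W → F} (hp : IsFactorMap X F p)
    (hp' : IsFactorMap X W p') (hg : Measurable g) (h : p =ᵐ[X.μ] g ∘ p') :
    IsFactorMap W F g where
  measurePreserving := by
    refine ⟨hg, ?_⟩
    rw [← hp'.measurePreserving.map_eq, Measure.map_map hg hp'.measurePreserving.measurable,
      ← Measure.map_congr h, hp.measurePreserving.map_eq]
  equivariant i := by
    have hm : MeasurableSet {w | g (W.T i w) = F.T i (g w)} :=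
      measurableSet_eq_fun (hg.comp (W.T i).measurable) ((F.T i).measurable.comp hg)
    -- Equivariance of `g` is a measurable condition on `W`, so it can be checked on `X`, where it
    -- follows from that of `p` and `p'`.
    rw [← hp'.measurePreserving.map_eq, ae_map_iff hp'.measurePreserving.aemeasurable hm]
    filter_upwards [hp.equivariant i, hp'.equivariant i, h,
      (X.measurePreserving i).quasiMeasurePreserving.ae h] with x h1 h2 h3 h4
    simp only [Function.comp_apply] at h3 h4
    rw [← h2, ← h4, h1, h3]

/-- Inclusion of factor σ-algebras gives a factor map between the factors. -/
theorem exists_isFactorMap_of_factorAlgebra_le {p : X → F} {p' : X → W}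
    (hp : IsFactorMap X F p) (hp' : IsFactorMap X W p')
    (h : factorAlgebra X F p ≤ factorAlgebra X W p') : ∃ g : W → F, IsFactorMap W F g := by
  obtain ⟨g, hg, hpg⟩ := exists_ae_eq_comp (p := p')
    ((measurable_factorAlgebra hp.measurePreserving.measurable).mono h le_rfl)
  exact ⟨g, hp.of_comp hp' hg hpg⟩

theorem Joining.integrable_comp_fst (lam : Joining X Y) {f : X → ℝ} (hf : Integrable f X.μ) :
    Integrable (fun z => f z.1) lam.measure :=
  lam.fst.integrable_comp_of_integrable hf

theorem integrable_of_bounded {f : X → ℝ} (hf : Measurable f) (hb : ∃ c, ∀ x, |f x| ≤ c) :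
    Integrable f X.μ := by
  obtain ⟨c, hc⟩ := hb
  exact Integrable.of_bound hf.aestronglyMeasurable c (Filter.Eventually.of_forall hc)

theorem Joining.condExp_snd_eq_iff (lam : Joining X Y) {u v : X × Y → ℝ}
    (hu : Integrable u lam.measure) (hv : Integrable v lam.measure) :
    lam.measure[u | Y.measurableSpace.comap Prod.snd] =ᵐ[lam.measure]
      lam.measure[v | Y.measurableSpace.comap Prod.snd] ↔
    ∀ B, MeasurableSet B → ∫ z in Prod.snd ⁻¹' B, u z ∂lam.measure =
      ∫ z in Prod.snd ⁻¹' B, v z ∂lam.measure := by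
  have hle := lam.snd.measurable.comap_le
  refine ⟨fun h B hB => ?_, fun h => ?_⟩
  · rw [← setIntegral_condExp hle hu ⟨B, hB, rfl⟩, ← setIntegral_condExp hle hv ⟨B, hB, rfl⟩]
    exact setIntegral_congr_ae (measurable_snd hB) (h.mono fun _ hx _ => hx)
  · refine ae_eq_condExp_of_forall_setIntegral_eq hle hv
      (fun _ _ _ => integrable_condExp.integrableOn) ?_
      stronglyMeasurable_condExp.aestronglyMeasurable
    intro s hs _
    rw [setIntegral_condExp hle hu hs]
    obtain ⟨B, hB, rfl⟩ := hs
    exact h B hB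

theorem Joining.setIntegral_snd_eq (lam : Joining X Y) {κ : Kernel X Y} [IsMarkovKernel κ]
    (hκ : lam.measure = X.μ ⊗ₘ κ) {u : X → ℝ} (hu : Integrable u X.μ) {B : Set Y}
    (hB : MeasurableSet B) :
    ∫ z in Prod.snd ⁻¹' B, u z.1 ∂lam.measure = ∫ x, u x * (κ x).real B ∂X.μ := by
  have h := lam.integrable_comp_fst hu
  rw [hκ] at h ⊢
  exact setIntegral_snd_compProd h hB

theorem integrable_mul_kernel {κ : Kernel X Y} [IsMarkovKernel κ] {u : X → ℝ}
    (hu : Integrable u X.μ) {B : Set Y} (hB : MeasurableSet B) :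
    Integrable (fun x => u x * (κ x).real B) X.μ := by
  refine hu.mul_bdd (c := 1) (κ.measurable_coe hB).ennreal_toReal.aestronglyMeasurable
    (Filter.Eventually.of_forall fun x => ?_)
  rw [Real.norm_of_nonneg measureReal_nonneg]
  exact measureReal_le_one

/-- A joining given by a kernel is relatively independent over every σ-algebra for which the kernel
is measurable. -/
theorem Joining.isRelIndepOver_of_kernel (lam : Joining X Y) (κ : Kernel X Y) [IsMarkovKernel κ]
    (hκ : lam.measure = X.μ ⊗ₘ κ) {m : MeasurableSpace X} (hm : m ≤ X.measurableSpace)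
    (h : ∀ B, MeasurableSet B → AEStronglyMeasurable[m] (fun x => (κ x).real B) X.μ) :
    lam.IsRelIndepOver m := by
  intro f hf hb
  have hfi := integrable_of_bounded hf hb
  have hci := integrable_condExp (f := f) (m := m) (μ := X.μ)
  rw [lam.condExp_snd_eq_iff (lam.integrable_comp_fst hfi) (lam.integrable_comp_fst hci)]
  intro B hB
  rw [lam.setIntegral_snd_eq hκ hfi hB, lam.setIntegral_snd_eq hκ hci hB]
  -- Since `x ↦ κ x B` is `m`-measurable, integrating against it does not distinguish `f` from its
  -- conditional expectation.
  exact (integral_condExp_mul hm hfi (h B hB) (integrable_mul_kernel hfi hB)).symm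

end MPSystem

/-! ### Joinings and equivariant kernels -/

namespace MeasureTheory

theorem MeasurePreserving.of_comp_left {α β γ : Type*} [MeasurableSpace α] [MeasurableSpace β]
    [MeasurableSpace γ] {μ : Measure α} {ν : Measure γ} {φ : α → β} {π : β → γ}
    (hφ : Measurable φ) (hπ : Measurable π) (h : MeasurePreserving (π ∘ φ) μ ν) :
    MeasurePreserving π (μ.map φ) ν :=
  ⟨hπ, by rw [Measure.map_map hπ hφ, h.map_eq]⟩

end MeasureTheory

namespace MPSystem

variable {d : ℕ} {X Y Z W F : MPSystem.{u} d}

theorem IsFactorMap.measurable {p : X → Y} (hp : IsFactorMap X Y p) : Measurable p :=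
  hp.measurePreserving.measurable

/-- The joining of two factors of a system. -/
noncomputable def Joining.ofFactorMaps {p : Z → X} {q : Z → Y} (hp : IsFactorMap Z X p)
    (hq : IsFactorMap Z Y q) : Joining X Y where
  measure := Z.μ.map fun z => (p z, q z)
  isProb := Measure.isProbabilityMeasure_map (hp.measurable.prodMk hq.measurable).aemeasurable
  fst := .of_comp_left (hp.measurable.prodMk hq.measurable) measurable_fst hp.measurePreserving
  snd := .of_comp_left (hp.measurable.prodMk hq.measurable) measurable_snd hq.measurePreserving
  invariant i := by
    refine MeasurePreserving.of_ae_semiconj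
      ((hp.measurable.prodMk hq.measurable).measurePreserving Z.μ) (Z.measurePreserving i)
      ((X.T i).prodCongr (Y.T i)).measurable ?_
    filter_upwards [hp.equivariant i, hq.equivariant i] with z h1 h2
    exact Prod.ext h1 h2

/-- The joining of a countable family of factors of a system. -/
noncomputable def FamilyJoining.ofFactorMaps {ι : Type} [Countable ι] {W : ι → MPSystem.{u} d}
    {p : ∀ k, Z → W k} (hp : ∀ k, IsFactorMap Z (W k) (p k)) : FamilyJoining W where
  measure := Z.μ.map fun z k => p k z
  isProb := Measure.isProbabilityMeasure_map
    (measurable_pi_lambda _ fun k => (hp k).measurable).aemeasurable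
  eval k := .of_comp_left (measurable_pi_lambda _ fun k => (hp k).measurable)
    (measurable_pi_apply k) (hp k).measurePreserving
  invariant i := by
    refine MeasurePreserving.of_ae_semiconj
      ((measurable_pi_lambda _ fun k => (hp k).measurable).measurePreserving Z.μ)
      (Z.measurePreserving i)
      (MeasurableEquiv.piCongrRight fun k => (W k).T i).measurable ?_
    filter_upwards [ae_all_iff.2 fun k => (hp k).equivariant i] with z h
    exact funext h

theorem FamilyJoining.isFactorMap_ofFactorMaps {ι : Type} [Countable ι] {W : ι → MPSystem.{u} d}
    {p : ∀ k, Z → W k} (hp : ∀ k, IsFactorMap Z (W k) (p k)) :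
    IsFactorMap Z (FamilyJoining.ofFactorMaps hp).toSystem fun z k => p k z where
  measurePreserving := (measurable_pi_lambda _ fun k => (hp k).measurable).measurePreserving Z.μ
  equivariant i := by
    filter_upwards [ae_all_iff.2 fun k => (hp k).equivariant i] with z h
    exact funext h

theorem Joining.isFactorMap_fst (lam : Joining X Y) : IsFactorMap lam.toSystem X Prod.fst where
  measurePreserving := lam.fst
  equivariant _ := Filter.Eventually.of_forall fun _ => rfl

theorem Joining.isFactorMap_snd (lam : Joining X Y) : IsFactorMap lam.toSystem Y Prod.snd where
  measurePreserving := lam.snd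
  equivariant _ := Filter.Eventually.of_forall fun _ => rfl

/-- A kernel between systems which commutes with the transformations and which transports the
measure of the first system to that of the second one. -/
structure IsEquivariantKernel (X Y : MPSystem.{u} d) (η : Kernel X Y) : Prop where
  markov : IsMarkovKernel η
  equivariant : ∀ i, ∀ᵐ x ∂X.μ, η (X.T i x) = (η x).map (Y.T i)
  snd : MeasurePreserving Prod.snd (X.μ ⊗ₘ η) Y.μ

/-- The joining defined by an equivariant kernel. -/
noncomputable def IsEquivariantKernel.joining {η : Kernel X Y} (hη : IsEquivariantKernel X Y η) :
    Joining X Y where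
  measure := X.μ ⊗ₘ η
  isProb := by have := hη.markov; infer_instance
  fst := by
    have := hη.markov
    exact ⟨measurable_fst, Measure.fst_compProd _ _⟩
  snd := hη.snd
  invariant i := by
    have := hη.markov
    exact Measure.measurePreserving_prodMap_compProd (X.measurePreserving i) (Y.T i).measurable
      (hη.equivariant i)

theorem Joining.isEquivariantKernel_condKernel (lam : Joining X Y) :
    IsEquivariantKernel X Y lam.measure.condKernel ∧
      lam.measure = X.μ ⊗ₘ lam.measure.condKernel := by
  have hfst : lam.measure.fst = X.μ := lam.fst.map_eq
  have h : lam.measure = X.μ ⊗ₘ lam.measure.condKernel := by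
    rw [← hfst, Measure.disintegrate]
  refine ⟨⟨inferInstance, fun i => ?_, ?_⟩, h⟩
  · rw [← hfst]
    exact Measure.ae_condKernel_map (X.T i) (Y.T i) (Y.T i).measurable (lam.invariant i)
  · rw [← h]
    exact lam.snd

/-- Relatively independent extension: the conditional measures of an extension `Y` of `F`, seen from
another extension `X` of `F`. -/
theorem exists_isEquivariantKernel {p : X → F} {q : Y → F} (hp : IsFactorMap X F p)
    (hq : IsFactorMap Y F q) :
    ∃ η : Kernel X Y, IsEquivariantKernel X Y η ∧
      (∃ κ : Kernel F Y, ∀ x, η x = κ (p x)) ∧ ∀ᵐ z ∂(X.μ ⊗ₘ η), p z.1 = q z.2 := by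
  have hid : IsFactorMap Y Y id :=
    ⟨MeasurePreserving.id _, fun _ => Filter.Eventually.of_forall fun _ => rfl⟩
  -- Disintegrating the graph joining of `F` and `Y` gives the conditional measures `κ` of `Y` over
  -- `F`; the kernel sought is `κ` composed with `p`.
  obtain ⟨⟨hκ, heq, hsnd⟩, hκ'⟩ := (Joining.ofFactorMaps hq hid).isEquivariantKernel_condKernel
  set κ := (Joining.ofFactorMaps hq hid).measure.condKernel
  have hmp : MeasurePreserving (Prod.map p id) (X.μ ⊗ₘ κ.comap p hp.measurable) (F.μ ⊗ₘ κ) :=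
    Measure.measurePreserving_prodMap_compProd hp.measurePreserving measurable_id
      (Filter.Eventually.of_forall fun x => by simp [Kernel.comap_apply])
  refine ⟨κ.comap p hp.measurable, ⟨inferInstance, fun i => ?_, hsnd.comp hmp⟩,
    ⟨κ, fun x => rfl⟩, ?_⟩
  · filter_upwards [hp.equivariant i, hp.measurePreserving.quasiMeasurePreserving.ae (heq i)]
      with x h1 h2
    rw [Kernel.comap_apply, Kernel.comap_apply, h1, h2]
  -- The identity is pulled back from the graph joining, which is carried by the points `(q y, y)`.
  · refine hmp.quasiMeasurePreserving.ae (p := fun z => z.1 = q z.2) ?_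
    rw [← hκ']
    refine (ae_map_iff (hq.measurable.prodMk measurable_id).aemeasurable
      (measurableSet_eq_fun measurable_fst (hq.measurable.comp measurable_snd))).2 ?_
    exact Filter.Eventually.of_forall fun _ => rfl

/-- The kernel obtained from the conditional measures of `Y` over `F` depends on `x` only through `p
x`, so the kernel criterion applies. -/
theorem exists_isRelIndepJoining {p : X → F} {q : Y → F} (hp : IsFactorMap X F p)
    (hq : IsFactorMap Y F q) : ∃ lam : Joining X Y, lam.IsRelIndepJoining F p q := by
  obtain ⟨η, hη, ⟨κ, hκ⟩, h⟩ := exists_isEquivariantKernel hp hq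
  have := hη.markov
  refine ⟨hη.joining, h, hη.joining.isRelIndepOver_of_kernel η rfl (factorAlgebra_le X F p)
    fun B hB => ?_⟩
  refine aestronglyMeasurable_factorAlgebra hp.measurable
    (h := fun w => (κ w).real B) (κ.measurable_coe hB).ennreal_toReal ?_
  exact Filter.Eventually.of_forall fun x => by simp [hκ]

theorem measurePreserving_eval_compProd_infinitePi {ι : Type} {Y : ι → MPSystem.{u} d}
    (η : ∀ k, Kernel X (Y k)) [∀ k, IsMarkovKernel (η k)] (k : ι) :
    MeasurePreserving (Prod.map id (fun y : ∀ k, Y k => y k))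
      (X.μ ⊗ₘ Kernel.infinitePi η) (X.μ ⊗ₘ η k) :=
  Measure.measurePreserving_prodMap_compProd (MeasurePreserving.id _) (measurable_pi_apply k)
    (Filter.Eventually.of_forall fun x => by
      rw [Kernel.infinitePi_apply, Measure.infinitePi_map_eval]; rfl)

/-- Equivariant kernels from `X` to the members of a countable family define a joining of the family
and an equivariant kernel from `X` to it, with independent coordinates over `X`. -/
theorem exists_isEquivariantKernel_infinitePi {ι : Type} [Countable ι] {Y : ι → MPSystem.{u} d}
    {η : ∀ k, Kernel X (Y k)} [∀ k, IsMarkovKernel (η k)]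
    (hη : ∀ k, IsEquivariantKernel X (Y k) (η k)) :
    ∃ L : FamilyJoining Y, IsEquivariantKernel X L.toSystem (Kernel.infinitePi η) := by
  have heq : ∀ i, ∀ᵐ x ∂X.μ, Kernel.infinitePi η (X.T i x) =
      (Kernel.infinitePi η x).map (MeasurableEquiv.piCongrRight fun k => (Y k).T i) := by
    intro i
    filter_upwards [ae_all_iff.2 fun k => (hη k).equivariant i] with x hx
    rw [Kernel.infinitePi_apply, Kernel.infinitePi_apply]
    refine Eq.trans ?_ (Measure.infinitePi_map_pi _ fun k => ((Y k).T i).measurable).symm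
    simp_rw [hx]
  have hinv : ∀ i, MeasurePreserving
      (Prod.map (X.T i) (MeasurableEquiv.piCongrRight fun k => (Y k).T i))
      (X.μ ⊗ₘ Kernel.infinitePi η) (X.μ ⊗ₘ Kernel.infinitePi η) := fun i =>
    Measure.measurePreserving_prodMap_compProd (X.measurePreserving i)
      (MeasurableEquiv.piCongrRight fun k => (Y k).T i).measurable (heq i)
  have hsnd : MeasurePreserving Prod.snd (X.μ ⊗ₘ Kernel.infinitePi η)
      ((X.μ ⊗ₘ Kernel.infinitePi η).map Prod.snd) := measurable_snd.measurePreserving _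
  have hmarkov : IsMarkovKernel (Kernel.infinitePi η) := inferInstance
  have hprob : IsProbabilityMeasure ((X.μ ⊗ₘ Kernel.infinitePi η).map Prod.snd) :=
    Measure.isProbabilityMeasure_map measurable_snd.aemeasurable
  -- The joining of the family is the second marginal; it inherits its invariance from the measure
  -- on the product with `X`.
  refine ⟨⟨(X.μ ⊗ₘ Kernel.infinitePi η).map Prod.snd, ?_, ?_⟩, ⟨hmarkov, heq, hsnd⟩⟩
  · exact fun k => .of_comp_left measurable_snd (measurable_pi_apply k) 
      ((hη k).snd.comp (measurePreserving_eval_compProd_infinitePi η k))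
  · exact fun i => hsnd.of_ae_semiconj (hinv i) (MeasurableEquiv.measurable _)
      (Filter.Eventually.of_forall fun _ => rfl)

end MPSystem

/-! ### The largest factor among factors of `C`-systems -/

namespace MPSystem

variable {d : ℕ} {X Y Z W F : MPSystem.{u} d} {C : Set (MPSystem.{u} d)}

theorem factorAlgebra_mono {p : X → W} {r : X → F} {g : F → W} (hg : Measurable g)
    (h : p =ᵐ[X.μ] g ∘ r) : factorAlgebra X W p ≤ factorAlgebra X F r := by
  rintro A ⟨hA, B, hB, hAB⟩
  refine ⟨hA, g ⁻¹' B, hg hB, hAB.trans ?_⟩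
  filter_upwards [h] with x hx
  refine propext ?_
  change p x ∈ B ↔ g (r x) ∈ B
  rw [hx]; rfl

/-- A countable family of factors of `X` which are factors of `C`-systems is contained in a factor
of the same kind. -/
theorem exists_factor_ge (hjoin : StableUnderCountableJoinings C) {ι : Type} [Countable ι]
    [Nonempty ι] {W : ι → MPSystem.{u} d} (hW : ∀ k, W k ∈ factorClass C) {p : ∀ k, X → W k}
    (hp : ∀ k, IsFactorMap X (W k) (p k)) :
    ∃ F ∈ factorClass C, ∃ r : X → F, IsFactorMap X F r ∧
      ∀ k, factorAlgebra X (W k) (p k) ≤ factorAlgebra X F r := by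
  choose Y hY q hq using hW
  choose η hη _ hpq using fun k => exists_isEquivariantKernel (hp k) (hq k)
  have hmarkov : ∀ k, IsMarkovKernel (η k) := fun k => (hη k).markov
  obtain ⟨L, hL⟩ := exists_isEquivariantKernel_infinitePi hη
  have hF := FamilyJoining.isFactorMap_ofFactorMaps hp
  refine ⟨_, ⟨L.toSystem, hjoin ι Y hY L, fun y k => q k (y k), ?_⟩, _, hF, fun k =>
    factorAlgebra_mono (measurable_pi_apply k) (ae_eq_refl _)⟩
  -- In the joining of `X` with `L`, the family of all `p k` is almost surely a function of the
  -- `L`-coordinate, so the join of the `W k` is a factor of a `C`-system.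
  refine (hF.comp hL.joining.isFactorMap_fst).of_comp hL.joining.isFactorMap_snd
    (measurable_pi_lambda _ fun k => (hq k).measurable.comp (measurable_pi_apply k)) ?_
  filter_upwards [ae_all_iff.2 fun k => (measurePreserving_eval_compProd_infinitePi η
    k).quasiMeasurePreserving.ae (hpq k)] with z hz
  exact funext hz

/-- The system with one point. -/
noncomputable def point (d : ℕ) : MPSystem.{u} d where
  carrier := PUnit
  μ := Measure.dirac PUnit.unit
  T _ := MeasurableEquiv.refl _
  measurePreserving _ := MeasurePreserving.id _
  comm _ _ _ := rfl

theorem isFactorMap_point (X : MPSystem.{u} d) :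
    IsFactorMap X (point d) fun _ => PUnit.unit where
  measurePreserving := 
    ⟨measurable_const, (Measure.map_const _ _).trans (by rw [measure_univ, one_smul]; rfl)⟩
  equivariant _ := Filter.Eventually.of_forall fun _ => rfl

theorem point_mem_factorClass (hne : C.Nonempty) : point d ∈ factorClass C := by
  obtain ⟨Y, hY⟩ := hne
  exact ⟨Y, hY, _, isFactorMap_point Y⟩

/-- Every system has a largest factor among the factors of `C`-systems. -/
theorem exists_isLargestClassFactor (hne : C.Nonempty) (hjoin : StableUnderCountableJoinings C)
    (X : MPSystem.{u} d) : ∃ (F : MPSystem.{u} d) (p : X → F), IsFactorMap X F p ∧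
      IsLargestClassFactor (factorClass C) X (factorAlgebra X F p) := by
  have : Fact ((1 : ENNReal) ≠ ⊤) := ⟨ENNReal.one_ne_top⟩
  let S : Set (Lp ℝ 1 X.μ) := {f | ∃ W ∈ factorClass C, ∃ p : X → W, IsFactorMap X W p ∧
    AEStronglyMeasurable[factorAlgebra X W p] f X.μ}
  obtain ⟨t, htS, htc, hSt⟩ :=
    (TopologicalSpace.IsSeparable.of_separableSpace S).exists_countable_dense_subset
  -- The one-point factor makes `S` nonempty, so that its countable dense subset can be enumerated
  -- by `ℕ`.
  have hS0 : (0 : Lp ℝ 1 X.μ) ∈ S :=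
    ⟨_, point_mem_factorClass hne, _, isFactorMap_point X,
      ⟨0, stronglyMeasurable_zero, Lp.coeFn_zero _ _ _⟩⟩
  have htne : t.Nonempty := closure_nonempty_iff.1 ⟨0, hSt hS0⟩
  obtain ⟨f, rfl⟩ := htc.exists_eq_range htne
  choose W hW p hp hf using fun n => htS (Set.mem_range_self n)
  obtain ⟨F, hFC, r, hr, hle⟩ := exists_factor_ge hjoin hW hp
  refine ⟨F, r, hr, ⟨F, hFC, r, hr, rfl⟩, ?_⟩
  rintro _ ⟨V, hV, s, hs, rfl⟩ A hA
  refine measurableSet_factorAlgebra_of_aestronglyMeasurable hA.1 ?_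
  -- Functions measurable for a fixed σ-algebra form a closed subset of `L¹`, so absorbing a dense
  -- sequence of `S` absorbs all of `S`, in particular the indicator of `A`.
  have hclosed := isClosed_aestronglyMeasurable (F := ℝ) (p := 1) (μ := X.μ)
    (factorAlgebra_le X F r)
  have hsub : S ⊆ {f | AEStronglyMeasurable[factorAlgebra X F r] f X.μ} := by
    refine hSt.trans (hclosed.closure_subset_iff.2 ?_)
    rintro _ ⟨n, rfl⟩
    exact (hf n).mono (hle n)
  have hmem : MemLp (A.indicator fun _ => (1 : ℝ)) 1 X.μ :=
    memLp_indicator_const 1 hA.1 1 (Or.inr (measure_ne_top _ _))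
  refine (hsub (a := hmem.toLp) ⟨V, hV, s, hs, ?_⟩).congr hmem.coeFn_toLp
  refine AEStronglyMeasurable.congr ?_ hmem.coeFn_toLp.symm
  exact (stronglyMeasurable_const.indicator hA).aestronglyMeasurable

end MPSystem

/-! ### The factor generated by a function along orbits -/

namespace MPSystem

variable {d : ℕ} {X Y Z W F V : MPSystem.{u} d} {C : Set (MPSystem.{u} d)}

/-- The action on a system of the group `ℤ ^ d`, in multiplicative notation. -/
noncomputable def act (X : MPSystem.{u} d) : (Fin d → Multiplicative ℤ) →* Equiv.Perm X :=
  MonoidHom.noncommPiCoprod (fun i => zpowersHom (Equiv.Perm X) (X.T i).toEquiv)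
    fun i j _ a b => by
      have h : Commute (X.T i).toEquiv (X.T j).toEquiv := Equiv.ext (X.comm i j)
      exact h.zpow_zpow _ _

/-- The generators of `ℤ ^ d`. -/
def gen (i : Fin d) : Fin d → Multiplicative ℤ := Pi.mulSingle i (Multiplicative.ofAdd 1)

theorem act_gen (X : MPSystem.{u} d) (i : Fin d) : X.act (gen i) = (X.T i).toEquiv := by
  refine (MonoidHom.noncommPiCoprod_mulSingle _ _ _).trans ?_
  simp

theorem mem_of_gen_mem (H : Subgroup (Fin d → Multiplicative ℤ)) (h : ∀ i, gen i ∈ H)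
    (v : Fin d → Multiplicative ℤ) : v ∈ H := by
  refine Subgroup.pi_mem_of_mulSingle_mem v fun i => ?_
  have h1 : Pi.mulSingle i (v i) =
      (gen i : Fin d → Multiplicative ℤ) ^ (Multiplicative.toAdd (v i)) := by
    rw [gen, ← Pi.mulSingle_zpow]
    congr 1
    rw [← ofAdd_zsmul, smul_eq_mul, mul_one, ofAdd_toAdd]
  rw [h1]
  exact H.zpow_mem (h i) _

theorem measurePreserving_act (X : MPSystem.{u} d) (v : Fin d → Multiplicative ℤ) :
    MeasurePreserving (X.act v) X.μ X.μ := by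
  -- The condition is imposed on `v` and `v⁻¹` together so that it defines a subgroup: measurability
  -- of a permutation does not by itself pass to its inverse.
  let H : Subgroup (Fin d → Multiplicative ℤ) :=
    { carrier := {v | MeasurePreserving (X.act v) X.μ X.μ ∧
        MeasurePreserving (X.act v⁻¹) X.μ X.μ}
      one_mem' := by
        rw [Set.mem_ofPred_eq, inv_one, map_one]
        exact ⟨MeasurePreserving.id X.μ, MeasurePreserving.id X.μ⟩
      mul_mem' := by
        rintro a b ⟨ha, ha'⟩ ⟨hb, hb'⟩
        refine ⟨?_, ?_⟩
        · rw [map_mul]; exact ha.comp hb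
        · rw [mul_inv_rev, map_mul]; exact hb'.comp ha'
      inv_mem' := by
        rintro a ⟨ha, ha'⟩
        exact ⟨ha', by rwa [inv_inv]⟩ }
  refine (mem_of_gen_mem H (fun i => ⟨?_, ?_⟩) v).1
  · rw [act_gen]; exact X.measurePreserving i
  · rw [map_inv, act_gen]; exact (X.measurePreserving i).symm

theorem apply_act {r : Z → X} (hr : ∀ i z, r (Z.T i z) = X.T i (r z))
    (v : Fin d → Multiplicative ℤ) (z : Z) : r (Z.act v z) = X.act v (r z) := by
  let H : Subgroup (Fin d → Multiplicative ℤ) :=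
    { carrier := {v | ∀ z, r (Z.act v z) = X.act v (r z)}
      one_mem' := fun z => by rw [map_one, map_one]; rfl
      mul_mem' := by
        intro a b ha hb z
        rw [map_mul, map_mul, Equiv.Perm.mul_apply, Equiv.Perm.mul_apply, ha, hb]
      inv_mem' := by
        intro a ha z
        rw [map_inv, map_inv, Equiv.Perm.eq_inv_iff_eq, ← ha]
        exact congrArg r ((Z.act a).apply_symm_apply z) }
  refine mem_of_gen_mem H (fun i z => ?_) v z
  rw [act_gen, act_gen]
  exact hr i z

/-- The shift by the `i`-th generator on the space of functions on `ℤ ^ d`. -/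
def shift (i : Fin d) :
    (ULift.{u} (Fin d → Multiplicative ℤ) → ℝ) ≃ᵐ (ULift.{u} (Fin d → Multiplicative ℤ) → ℝ) where
  toFun x v := x ⟨v.down * gen i⟩
  invFun x v := x ⟨v.down * (gen i)⁻¹⟩
  left_inv x := by funext v; simp
  right_inv x := by funext v; simp
  measurable_toFun := measurable_pi_lambda _ fun _ => measurable_pi_apply _
  measurable_invFun := measurable_pi_lambda _ fun _ => measurable_pi_apply _

/-- The values of a function along the orbits. -/
noncomputable def orbitMap (X : MPSystem.{u} d) (h : X → ℝ) (x : X)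
    (v : ULift.{u} (Fin d → Multiplicative ℤ)) : ℝ := h (X.act v.down x)

theorem measurable_orbitMap {h : X → ℝ} (hh : Measurable h) : Measurable (X.orbitMap h) :=
  measurable_pi_lambda _ fun v => hh.comp (X.measurePreserving_act v.down).measurable

theorem orbitMap_T (h : X → ℝ) (i : Fin d) (x : X) :
    X.orbitMap h (X.T i x) = shift i (X.orbitMap h x) := by
  funext v
  change h (X.act v.down (X.T i x)) = h (X.act (v.down * gen i) x)
  rw [map_mul, act_gen]
  rfl

/-- The factor generated by a measurable function. -/
noncomputable def orbitSystem {h : X → ℝ} (hh : Measurable h) : MPSystem.{u} d where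
  -- `ULift` places the function space in universe `u`; the index set is countable, so this product
  -- is standard Borel.
  carrier := ULift.{u} (Fin d → Multiplicative ℤ) → ℝ
  μ := X.μ.map (X.orbitMap h)
  isProb := Measure.isProbabilityMeasure_map (measurable_orbitMap hh).aemeasurable
  T := shift
  measurePreserving i := ((measurable_orbitMap hh).measurePreserving X.μ).of_ae_semiconj
    (X.measurePreserving i) (shift i).measurable
    (Filter.Eventually.of_forall fun x => orbitMap_T h i x)
  comm i j x := by
    funext v
    change x ⟨v.down * gen i * gen j⟩ = x ⟨v.down * gen j * gen i⟩
    rw [mul_right_comm]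

theorem isFactorMap_orbitSystem {h : X → ℝ} (hh : Measurable h) :
    IsFactorMap X (orbitSystem hh) (X.orbitMap h) where
  measurePreserving := (measurable_orbitMap hh).measurePreserving X.μ
  equivariant i := Filter.Eventually.of_forall fun x => orbitMap_T h i x

/-- A function on `X` which, in some joining with a `C`-system, is also a function on this system,
is measurable for a factor of `X` which is a factor of a `C`-system. -/
theorem exists_factor_of_ae_eq (hV : V ∈ C) (lam : Joining X V) {h : X → ℝ} (hh : Measurable h)
    {φ : V → ℝ} (hφ : Measurable φ) (heq : ∀ᵐ z ∂lam.measure, h z.1 = φ z.2) :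
    ∃ F ∈ factorClass C, ∃ p : X → F, IsFactorMap X F p ∧
      AEStronglyMeasurable[factorAlgebra X F p] h X.μ := by
  have hp := isFactorMap_orbitSystem hh
  refine ⟨orbitSystem hh, ⟨V, hV, V.orbitMap φ, ?_⟩, X.orbitMap h, hp, ?_⟩
  · refine (hp.comp lam.isFactorMap_fst).of_comp lam.isFactorMap_snd (measurable_orbitMap hφ) ?_
    -- The joint action preserves the joining and the group is countable, so the identity `heq`
    -- holds along almost every whole orbit.
    have : ∀ᵐ z ∂lam.measure, ∀ v : ULift.{u} (Fin d → Multiplicative ℤ),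
        h (X.act v.down z.1) = φ (V.act v.down z.2) := by
      refine ae_all_iff.2 fun v => ?_
      filter_upwards [(lam.toSystem.measurePreserving_act v.down).quasiMeasurePreserving.ae heq]
        with z hz
      have h1 : (lam.toSystem.act v.down z).1 = X.act v.down z.1 :=
        apply_act (Z := lam.toSystem) (r := Prod.fst) (fun _ _ => rfl) v.down z
      have h2 : (lam.toSystem.act v.down z).2 = V.act v.down z.2 :=
        apply_act (Z := lam.toSystem) (r := Prod.snd) (fun _ _ => rfl) v.down z
      rw [← h1, ← h2]
      exact hz
    filter_upwards [this] with z hz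
    exact funext hz
  -- `h` is the coordinate of its orbit map at the identity of the group.
  · refine aestronglyMeasurable_factorAlgebra hp.measurable
      (h := fun x : ULift.{u} (Fin d → Multiplicative ℤ) → ℝ => x ⟨1⟩)
      (measurable_pi_apply _) (Filter.Eventually.of_forall fun x => ?_)
    change h x = h (X.act 1 x)
    rw [map_one]
    rfl

end MPSystem

/-! ### Recovering a kernel from independent samples -/

namespace MeasureTheory

/-- The strong law of large numbers for an independent sequence of points with law `ν`. -/
theorem Measure.ae_tendsto_average_infinitePi {α : Type*} [MeasurableSpace α] (ν : Measure α)
    [IsProbabilityMeasure ν] {B : Set α} (hB : MeasurableSet B) :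
    ∀ᵐ w ∂(Measure.infinitePi fun _ : ℕ => ν), Filter.Tendsto
      (fun n : ℕ => (∑ i ∈ Finset.range n, B.indicator (fun _ => (1 : ℝ)) (w i)) / n)
      Filter.atTop (nhds (ν.real B)) := by
  have hg : Measurable (B.indicator fun _ => (1 : ℝ)) := measurable_const.indicator hB
  have hmp : ∀ i : ℕ, MeasurePreserving (fun w : ℕ → α => w i)
      (Measure.infinitePi fun _ : ℕ => ν) ν := fun i =>
    measurePreserving_eval_infinitePi (fun _ : ℕ => ν) i
  have hint : Integrable (B.indicator fun _ => (1 : ℝ)) ν :=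
    (integrable_const 1).indicator hB
  have hind := iIndepFun_infinitePi (P := fun _ : ℕ => ν)
    (X := fun _ => B.indicator fun _ => (1 : ℝ)) fun _ => hg
  have key := strong_law_ae_real (μ := Measure.infinitePi fun _ : ℕ => ν)
    (fun i w => B.indicator (fun _ => (1 : ℝ)) (w i))
    ((hmp 0).integrable_comp_of_integrable hint)
    (fun i j hij => hind.indepFun hij)
    (fun i => by
      refine ⟨(hg.comp (hmp i).measurable).aemeasurable,
        (hg.comp (hmp 0).measurable).aemeasurable, ?_⟩
      have h : ∀ j, Measure.map (fun w : ℕ → α => B.indicator (fun _ => (1 : ℝ)) (w j))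
          (Measure.infinitePi fun _ : ℕ => ν) = ν.map (B.indicator fun _ => (1 : ℝ)) := fun j =>
        (Measure.map_map hg (hmp j).measurable).symm.trans (by rw [(hmp j).map_eq])
      rw [h i, h 0])
  have hval : ∫ w, B.indicator (fun _ => (1 : ℝ)) (w 0) ∂(Measure.infinitePi fun _ : ℕ => ν) =
      ν.real B :=
    (integral_map (hmp 0).measurable.aemeasurable hg.aestronglyMeasurable).symm.trans (by
      rw [(hmp 0).map_eq]
      exact integral_indicator_one hB)
  rwa [hval] at key

end MeasureTheory

namespace MPSystem

variable {d : ℕ} {X Y Z W F V : MPSystem.{u} d} {C : Set (MPSystem.{u} d)}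

/-- Given `x`, the copies of `W` are independent with law `κ x`, so the frequency of visits to `B`
recovers `κ x B` from the copies alone, which form a `C`-system. -/
theorem Joining.exists_factor_condKernel (hjoin : StableUnderCountableJoinings C) (hW : W ∈ C)
    (lam : Joining X W) {B : Set W} (hB : MeasurableSet B) :
    ∃ F ∈ factorClass C, ∃ p : X → F, IsFactorMap X F p ∧
      AEStronglyMeasurable[factorAlgebra X F p]
        (fun x => (lam.measure.condKernel x).real B) X.μ := by
  set κ := lam.measure.condKernel
  obtain ⟨L, hL⟩ := exists_isEquivariantKernel_infinitePi (Y := fun _ : ℕ => W)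
    (η := fun _ => κ) fun _ => lam.isEquivariantKernel_condKernel.1
  have hB1 : Measurable (B.indicator fun _ => (1 : ℝ)) := measurable_const.indicator hB
  -- The upper limit is measurable without any convergence assumption, and it is the limit wherever
  -- the averages converge.
  let φ : (ℕ → W) → ℝ := fun w => Filter.limsup
    (fun n : ℕ => (∑ i ∈ Finset.range n, B.indicator (fun _ => (1 : ℝ)) (w i)) / n) Filter.atTop
  have hφ : Measurable φ := Measurable.limsup fun n =>
    (Finset.measurable_fun_sum _ fun i _ => hB1.comp (measurable_pi_apply i)).div_const _
  have hh : Measurable fun x => (κ x).real B := (κ.measurable_coe hB).ennreal_toReal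
  refine exists_factor_of_ae_eq (hjoin ℕ _ (fun _ => hW) L) hL.joining hh hφ ?_
  refine Measure.ae_compProd_of_ae_ae (κ := Kernel.infinitePi fun _ : ℕ => κ)
    (measurableSet_eq_fun (hh.comp measurable_fst) (hφ.comp measurable_snd))
    (Filter.Eventually.of_forall fun x => ?_)
  filter_upwards [(κ x).ae_tendsto_average_infinitePi hB] with w hw
  exact hw.limsup_eq.symm

/-- Every joining with a `C`-system is relatively independent over the largest factor which is a
factor of a `C`-system. -/
theorem Joining.isRelIndepOver_of_isLargestClassFactor (hjoin : StableUnderCountableJoinings C)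
    (hW : W ∈ C) (lam : Joining X W) {p : X → F}
    (hm : IsLargestClassFactor (factorClass C) X (factorAlgebra X F p)) :
    lam.IsRelIndepOver (factorAlgebra X F p) := by
  refine lam.isRelIndepOver_of_kernel _ lam.isEquivariantKernel_condKernel.2
    (factorAlgebra_le X F p) fun B hB => ?_
  obtain ⟨F', hF', p', hp', h⟩ := lam.exists_factor_condKernel hjoin hW hB
  exact h.mono (hm.2 ⟨F', hF', p', hp', rfl⟩)

end MPSystem

/-! ### Satedness of the relatively independent joining -/

namespace MeasureTheory

theorem setIntegral_eq_integral_indicator_mul {α : Type*} [MeasurableSpace α] (μ : Measure α)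
    {R : Set α} (hR : MeasurableSet R) (k : α → ℝ) :
    ∫ z in R, k z ∂μ = ∫ z, R.indicator 1 z * k z ∂μ := by
  rw [← integral_indicator hR]
  congr 1
  funext z
  by_cases hz : z ∈ R <;> simp [hz]

/-- Conditional expectation is self-adjoint: with `w` the indicator of `R`, both sides equal the
integral of `E[w | m] * E[h | m]`, once the hypothesis allows `w` to be replaced by `E[w | m]`
against `h`. -/
theorem setIntegral_condExp_of_integral_condExp_indicator_mul {α : Type*} {m m0 : MeasurableSpace α}
    {μ : Measure α} [IsFiniteMeasure μ] (hm : m ≤ m0) {R : Set α} (hR : MeasurableSet[m0] R)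
    {h k : α → ℝ} (hh : Integrable h μ) (hb : ∀ x, ‖h x‖ ≤ 1)
    (hk : μ[R.indicator 1 | m] =ᵐ[μ] k) (hRk : ∫ x in R, h x ∂μ = ∫ x, k x * h x ∂μ) :
    ∫ x in R, h x ∂μ = ∫ x in R, (μ[h | m]) x ∂μ := by
  have hw : Integrable (R.indicator (1 : α → ℝ)) μ := (integrable_const 1).indicator hR
  have hwb : ∀ x, ‖R.indicator (1 : α → ℝ) x‖ ≤ 1 := fun x => by
    by_cases hx : x ∈ R <;> simp [hx]
  rw [hRk, setIntegral_eq_integral_indicator_mul μ hR, ← integral_condExp_mul hm hw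
    stronglyMeasurable_condExp.aestronglyMeasurable (integrable_condExp.bdd_mul
      hw.aestronglyMeasurable (Filter.Eventually.of_forall hwb))]
  have h1 := integral_condExp_mul hm hh (h := μ[R.indicator 1 | m])
    stronglyMeasurable_condExp.aestronglyMeasurable (integrable_condExp.bdd_mul
      hh.aestronglyMeasurable (Filter.Eventually.of_forall hb))
  calc ∫ x, k x * h x ∂μ = ∫ x, h x * (μ[R.indicator 1 | m]) x ∂μ := by
        refine integral_congr_ae ?_
        filter_upwards [hk] with x hx
        rw [hx, mul_comm]
    _ = ∫ x, (μ[R.indicator 1 | m]) x * (μ[h | m]) x ∂μ := by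
        rw [← h1]
        exact integral_congr_ae (Filter.Eventually.of_forall fun x => mul_comm _ _)

end MeasureTheory

namespace MPSystem

variable {d : ℕ} {X Y Z W F V : MPSystem.{u} d} {C : Set (MPSystem.{u} d)}

/-- The conditional expectation is a function of `p x`, and `p x = q y` almost surely. -/
theorem exists_condExp_fst_ae_eq_snd {lam : Joining X Y} {p : X → F} {q : Y → F}
    (hq : Measurable q) (h : ∀ᵐ z ∂lam.measure, p z.1 = q z.2) (f : X → ℝ) :
    ∃ g : Y → ℝ, Measurable g ∧
      (fun z : X × Y => X.μ[f | factorAlgebra X F p] z.1) =ᵐ[lam.measure] fun z => g z.2 := by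
  obtain ⟨g, hg, hfg⟩ := aestronglyMeasurable_comap_of_factorAlgebra (X := X) (p := p)
    (f := X.μ[f | factorAlgebra X F p]) stronglyMeasurable_condExp.aestronglyMeasurable
  refine ⟨g ∘ q, hg.comp hq, ?_⟩
  filter_upwards [lam.fst.quasiMeasurePreserving.ae hfg, h] with z h1 h2
  simp only [Function.comp_apply] at h1 ⊢
  rw [h1, h2]

/-- In the relatively independent joining, the conditional expectation on `Y` of a function on `X`
is its conditional expectation on the common factor. -/
theorem Joining.IsRelIndepJoining.condExp_fst {lam : Joining X Y} {p : X → F} {q : Y → F}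
    (hlam : lam.IsRelIndepJoining F p q) (hq : Measurable q) {f : X → ℝ}
    (hf : Measurable f) (hb : ∃ c, ∀ x, |f x| ≤ c) :
    lam.toSystem.μ[fun z => f z.1 | factorAlgebra lam.toSystem Y Prod.snd] =ᵐ[lam.toSystem.μ]
      fun z => X.μ[f | factorAlgebra X F p] z.1 := by
  obtain ⟨g, hg, hGg⟩ := exists_condExp_fst_ae_eq_snd hq hlam.1 f
  have h1 := condExp_factorAlgebra (X := lam.toSystem) (p := Prod.snd) lam.snd.measurable
    (lam.integrable_comp_fst (integrable_of_bounded hf hb))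
  refine h1.trans ((hlam.2 f hf hb).trans ?_)
  -- The function already depends only on the `Y`-coordinate, so conditioning on `Y` leaves it
  -- unchanged.
  refine condExp_of_aestronglyMeasurable' lam.snd.measurable.comap_le ?_
    (lam.integrable_comp_fst integrable_condExp)
  exact ⟨g ∘ Prod.snd, (hg.comp (comap_measurable _)).stronglyMeasurable, hGg⟩

/-- The equivariant kernel defined by a factor map. -/
theorem IsFactorMap.isEquivariantKernel {r : X → Y} (hr : IsFactorMap X Y r) :
    IsEquivariantKernel X Y (Kernel.deterministic r hr.measurable) where
  markov := inferInstance
  equivariant i := by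
    filter_upwards [hr.equivariant i] with x hx
    rw [Kernel.deterministic_apply, Kernel.deterministic_apply, hx]
    exact (Measure.map_dirac' (Y.T i).measurable _).symm
  snd := ⟨measurable_snd, by
    rw [← hr.measurePreserving.map_eq, ← Measure.deterministic_comp_eq_map hr.measurable,
      ← Measure.snd_compProd]
    rfl⟩

/-- The members of the family `Y, V`. -/
def pair (Y V : MPSystem.{u} d) (b : Bool) : MPSystem.{u} d := bif b then Y else V

theorem setIntegral_mul_kernel {lam : Joining X Y} {η : Kernel lam.toSystem V}
    (hη : IsEquivariantKernel lam.toSystem V η) {g : X → ℝ} (hg : Integrable g X.μ) {B : Set Y}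
    (hB : MeasurableSet B) {D : Set V} (hD : MeasurableSet D) :
    ∫ z in {z | z.1.2 ∈ B ∧ z.2 ∈ D}, g z.1.1 ∂hη.joining.measure =
      ∫ z, (g z.1 * B.indicator 1 z.2) * (η z).real D ∂lam.toSystem.μ := by
  have := hη.markov
  have hgB : Integrable (fun z : X × Y => g z.1 * B.indicator 1 z.2) lam.toSystem.μ := by
    refine (lam.integrable_comp_fst hg).mul_bdd (c := 1)
      ((measurable_one.indicator hB).comp measurable_snd).aestronglyMeasurable
      (Filter.Eventually.of_forall fun z => ?_)
    by_cases hz : z.2 ∈ B <;> simp [hz]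
  rw [← hη.joining.setIntegral_snd_eq rfl hgB hD]
  have hE : MeasurableSet {z : (X × Y) × V | z.1.2 ∈ B} :=
    (measurable_snd.comp measurable_fst) hB
  have h1 : (fun z : (X × Y) × V => g z.1.1 * B.indicator 1 z.1.2) =
      {z : (X × Y) × V | z.1.2 ∈ B}.indicator fun z => g z.1.1 := by
    funext z
    by_cases hz : z.1.2 ∈ B <;> simp [hz]
  have h2 : {z : (X × Y) × V | z.1.2 ∈ B ∧ z.2 ∈ D} =
      Prod.snd ⁻¹' D ∩ {z : (X × Y) × V | z.1.2 ∈ B} := by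
    ext z; exact and_comm
  exact (congrArg (fun s => ∫ z in s, g z.1.1 ∂hη.joining.measure) h2).trans
    ((setIntegral_indicator hE).symm.trans
      (congrArg (fun f : (X × Y) × V → ℝ => ∫ z in Prod.snd ⁻¹' D, f z ∂hη.joining.measure) h1.symm))

/-- The factor maps from a joining of a joining of `X` and `Y` with `V` to the members of the family
`Y, V`. -/
def Joining.toPair {lam : Joining X Y} (M : Joining lam.toSystem V) :
    ∀ b, M.toSystem → pair Y V b
  | true => fun z => z.1.2
  | false => fun z => z.2

theorem Joining.isFactorMap_toPair {lam : Joining X Y} (M : Joining lam.toSystem V) (b : Bool) :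
    IsFactorMap M.toSystem (pair Y V b) (Joining.toPair M b) := by
  cases b
  · exact M.isFactorMap_snd
  · exact lam.isFactorMap_snd.comp M.isFactorMap_fst

theorem pair_mem (hY : Y ∈ C) (hV : V ∈ C) (b : Bool) : pair Y V b ∈ C := by
  cases b
  · exact hV
  · exact hY

/-- The joint law of `(Y, V)` defines a single `C`-system, so its joining with `X` is relatively
independent over the largest factor; this is tested on the rectangle `B × D`. -/
theorem Joining.setIntegral_condExp_pair (hjoin : StableUnderCountableJoinings C) {p : X → F}
    (hm : IsLargestClassFactor (factorClass C) X (factorAlgebra X F p)) (hY : Y ∈ C) (hV : V ∈ C)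
    {lam : Joining X Y} (M : Joining lam.toSystem V) {f : X → ℝ} (hf : Measurable f)
    (hb : ∃ c, ∀ x, |f x| ≤ c) {B : Set Y} (hB : MeasurableSet B) {D : Set V}
    (hD : MeasurableSet D) :
    ∫ z in {z | z.1.2 ∈ B ∧ z.2 ∈ D}, f z.1.1 ∂M.measure =
      ∫ z in {z | z.1.2 ∈ B ∧ z.2 ∈ D}, X.μ[f | factorAlgebra X F p] z.1.1 ∂M.measure := by
  have hL := FamilyJoining.isFactorMap_ofFactorMaps (Joining.isFactorMap_toPair M)
  have hX := lam.isFactorMap_fst.comp M.isFactorMap_fst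
  set L := FamilyJoining.ofFactorMaps (Joining.isFactorMap_toPair M)
  have hfi := integrable_of_bounded hf hb
  let N := Joining.ofFactorMaps hX hL
  have hE : MeasurableSet {w : ∀ b, pair Y V b | w true ∈ B ∧ w false ∈ D} :=
    (measurable_pi_apply (X := fun b => pair Y V b) true hB).inter
      (measurable_pi_apply (X := fun b => pair Y V b) false hD)
  have key := (N.condExp_snd_eq_iff (N.integrable_comp_fst hfi)
    (N.integrable_comp_fst integrable_condExp)).1
    (N.isRelIndepOver_of_isLargestClassFactor hjoin (hjoin Bool _ (pair_mem hY hV) L) hm f hf hb)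
    _ hE
  have hmap : ∀ g : X → ℝ, Integrable g X.μ →
      ∫ z in Prod.snd ⁻¹' {w : ∀ b, pair Y V b | w true ∈ B ∧ w false ∈ D}, g z.1 ∂N.measure =
        ∫ z in {z | z.1.2 ∈ B ∧ z.2 ∈ D}, g z.1.1 ∂M.measure := fun g hg =>
    setIntegral_map (measurable_snd hE) (N.integrable_comp_fst hg).aestronglyMeasurable
      (hX.measurable.prodMk hL.measurable).aemeasurable
  exact (hmap f hfi).symm.trans (key.trans (hmap _ integrable_condExp))

/-- Over the relatively independent joining with an extension in `C` of the largest factor in the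
class of factors of `C`-systems, equivariant kernels to `C`-systems are measurable for that
extension. -/
theorem Joining.IsRelIndepJoining.aestronglyMeasurable_kernel
    (hjoin : StableUnderCountableJoinings C) {p : X → F}
    (hm : IsLargestClassFactor (factorClass C) X (factorAlgebra X F p)) (hY : Y ∈ C) {q : Y → F}
    (hq : Measurable q) {lam : Joining X Y} (hlam : lam.IsRelIndepJoining F p q) (hV : V ∈ C)
    {η : Kernel lam.toSystem V} (hη : IsEquivariantKernel lam.toSystem V η) {D : Set V}
    (hD : MeasurableSet D) :
    AEStronglyMeasurable[factorAlgebra lam.toSystem Y Prod.snd] (fun z => (η z).real D)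
      lam.toSystem.μ := by
  have := hη.markov
  have hle := factorAlgebra_le lam.toSystem Y Prod.snd
  have hint : Integrable (fun z => (η z).real D) lam.toSystem.μ := by
    simpa using integrable_mul_kernel (κ := η) (integrable_const (1 : ℝ)) hD
  suffices h : (fun z => (η z).real D) =ᵐ[lam.toSystem.μ]
      lam.toSystem.μ[fun z => (η z).real D | factorAlgebra lam.toSystem Y Prod.snd] from
    stronglyMeasurable_condExp.aestronglyMeasurable.congr h.symm
  -- On a rectangle `A ×ˢ B` the `X`-part and the `Y`-part separate: the conditional expectation of
  -- its indicator on `Y` is `G` times the indicator of `B`.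
  refine ae_eq_of_setIntegral_prod_eq hint integrable_condExp fun A B hA hB => ?_
  let f : X → ℝ := A.indicator 1
  let G : X → ℝ := X.μ[f | factorAlgebra X F p]
  have hf : Measurable f := measurable_one.indicator hA
  have hfb : ∀ x, |f x| ≤ 1 := fun x => by by_cases hx : x ∈ A <;> simp [f, hx]
  have hfi := integrable_of_bounded hf ⟨1, hfb⟩
  have hw : (A ×ˢ B).indicator 1 = (fun z : X × Y => f z.1) * fun z => B.indicator 1 z.2 := by
    funext z
    by_cases h1 : z.1 ∈ A <;> by_cases h2 : z.2 ∈ B <;> simp [f, h1, h2, Set.indicator]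
  have hwi : Integrable ((A ×ˢ B).indicator (1 : X × Y → ℝ)) lam.measure :=
    (integrable_const 1).indicator (hA.prod hB)
  refine setIntegral_condExp_of_integral_condExp_indicator_mul
    (k := fun z : X × Y => G z.1 * B.indicator 1 z.2) hle (hA.prod hB) hint (fun z => ?_) ?_ ?_
  · rw [Real.norm_of_nonneg measureReal_nonneg]
    exact measureReal_le_one
  · have hv : AEStronglyMeasurable[factorAlgebra lam.toSystem Y Prod.snd]
        (fun z : X × Y => B.indicator (1 : Y → ℝ) z.2) lam.toSystem.μ :=
      aestronglyMeasurable_factorAlgebra (X := lam.toSystem) measurable_snd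
        (measurable_one.indicator hB) (ae_eq_refl _)
    rw [hw] at hwi
    refine (Filter.EventuallyEq.of_eq (congrArg (fun w : lam.toSystem → ℝ =>
      lam.toSystem.μ[w | factorAlgebra lam.toSystem Y Prod.snd]) hw)).trans ?_
    refine (condExp_mul_of_aestronglyMeasurable_right hv hwi
      (lam.integrable_comp_fst hfi)).trans ?_
    filter_upwards [hlam.condExp_fst hq hf ⟨1, hfb⟩] with z hz
    exact congrArg (· * B.indicator (1 : Y → ℝ) z.2) hz
  -- Integrals against `η` become integrals over the joining with `V`, where relative independence
  -- from `(Y, V)` replaces `f` by `G`.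
  · have e3 := setIntegral_mul_kernel hη hfi hB hD
    have e4 := setIntegral_mul_kernel hη (g := G) integrable_condExp hB hD
    have e5 := Joining.setIntegral_condExp_pair hjoin hm hY hV hη.joining hf ⟨1, hfb⟩ hB hD
    refine (setIntegral_eq_integral_indicator_mul lam.measure (hA.prod hB) _).trans ?_
    rw [hw]
    exact e3.symm.trans (e5.trans e4)

/-- The relatively independent joining of `X` with an extension in `C` of its largest factor in the
class of factors of `C`-systems is `C`-sated. -/
theorem Joining.IsRelIndepJoining.isSated (hjoin : StableUnderCountableJoinings C) {p : X → F}
    (hm : IsLargestClassFactor (factorClass C) X (factorAlgebra X F p)) (hY : Y ∈ C) {q : Y → F}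
    (hq : Measurable q) {lam : Joining X Y} (hlam : lam.IsRelIndepJoining F p q) :
    IsSated C lam.toSystem := by
  refine ⟨factorAlgebra lam.toSystem Y Prod.snd,
    ⟨⟨Y, hY, Prod.snd, lam.isFactorMap_snd, rfl⟩, ?_⟩, fun V hV M => ?_⟩
  · rintro _ ⟨V, hV, r, hr, rfl⟩ A ⟨hA, D, hD, hAD⟩
    refine measurableSet_factorAlgebra_of_aestronglyMeasurable hA ?_
    -- For the deterministic kernel of `r`, the mass given to `D` is the indicator of `r ⁻¹' D`,
    -- which is that of `A` up to a null set.
    refine (hlam.aestronglyMeasurable_kernel hjoin hm hY hq hV hr.isEquivariantKernel hD).congr ?_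
    filter_upwards [hAD.mem_iff] with z hz
    rw [Kernel.deterministic_apply, measureReal_def, Measure.dirac_apply' _ hD]
    by_cases h : r z ∈ D
    · rw [Set.indicator_of_mem h, Set.indicator_of_mem (hz.2 h)]; simp
    · rw [Set.indicator_of_notMem h, Set.indicator_of_notMem fun h' => h (hz.1 h')]; simp
  · obtain ⟨h1, h2⟩ := M.isEquivariantKernel_condKernel
    exact M.isRelIndepOver_of_kernel _ h2 (factorAlgebra_le _ _ _) fun D hD =>
      hlam.aestronglyMeasurable_kernel hjoin hm hY hq hV h1 hD

end MPSystem

theorem mainTheorem2 {d : ℕ} (C : Set (MPSystem.{u} d)) (hne : C.Nonempty)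
    (hiso : MPSystem.StableUnderIsomorphism C)
    (hjoin : MPSystem.StableUnderCountableJoinings C) (X : MPSystem.{u} d) :
    -- `X` has a `C`-sated extension
    (∃ (Z : MPSystem.{u} d) (r : Z → X), MPSystem.IsFactorMap Z X r ∧ MPSystem.IsSated C Z) ∧
    -- `X` has a largest factor in the class of factors of `C`-systems
    (∃ (F : MPSystem.{u} d) (p : X → F), MPSystem.IsFactorMap X F p ∧
      MPSystem.IsLargestClassFactor (MPSystem.factorClass C) X
        (MPSystem.factorAlgebra X F p)) ∧
    -- for every model `F` of this largest factor,
    (∀ (F : MPSystem.{u} d) (p : X → F), MPSystem.IsFactorMap X F p →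
      MPSystem.IsLargestClassFactor (MPSystem.factorClass C) X
        (MPSystem.factorAlgebra X F p) →
      -- `F` has an extension in the class `C`, and for each such extension `Y`
      (∃ Y ∈ C, ∃ q : Y → F, MPSystem.IsFactorMap Y F q) ∧
      ∀ Y ∈ C, ∀ q : Y → F, MPSystem.IsFactorMap Y F q →
        -- the relatively independent joining of `X` and `Y` over `F` exists,
        (∃ lam : MPSystem.Joining X Y, lam.IsRelIndepJoining F p q) ∧
        -- and it is a `C`-sated extension of `X`
        ∀ lam : MPSystem.Joining X Y, lam.IsRelIndepJoining F p q →
          MPSystem.IsFactorMap lam.toSystem X Prod.fst ∧ MPSystem.IsSated C lam.toSystem) := by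

  have h3 : ∀ (F : MPSystem.{u} d) (p : X → F), MPSystem.IsFactorMap X F p →
      MPSystem.IsLargestClassFactor (MPSystem.factorClass C) X (MPSystem.factorAlgebra X F p) →
      (∃ Y ∈ C, ∃ q : Y → F, MPSystem.IsFactorMap Y F q) ∧
      ∀ Y ∈ C, ∀ q : Y → F, MPSystem.IsFactorMap Y F q →
        (∃ lam : MPSystem.Joining X Y, lam.IsRelIndepJoining F p q) ∧
        ∀ lam : MPSystem.Joining X Y, lam.IsRelIndepJoining F p q →
          MPSystem.IsFactorMap lam.toSystem X Prod.fst ∧ MPSystem.IsSated C lam.toSystem := by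
    intro F p hp hm
    refine ⟨?_, fun Y hY q hq => ⟨MPSystem.exists_isRelIndepJoining hp hq, fun lam hlam =>
      ⟨lam.isFactorMap_fst, hlam.isSated hjoin hm hY hq.measurable⟩⟩⟩
    -- Membership in the class is known for some model `W` of the largest factor, not for `F`;
    -- equality of the σ-algebras gives a factor map from `W` to `F`.
    obtain ⟨W, ⟨Y, hY, r, hr⟩, p', hp', hpp'⟩ := hm.1
    obtain ⟨g, hg⟩ := MPSystem.exists_isFactorMap_of_factorAlgebra_le hp hp' hpp'.le
    exact ⟨Y, hY, g ∘ r, hg.comp hr⟩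
  have h2 := MPSystem.exists_isLargestClassFactor hne hjoin X
  refine ⟨?_, h2, h3⟩
  obtain ⟨F, p, hp, hm⟩ := h2
  obtain ⟨⟨Y, hY, q, hq⟩, h⟩ := h3 F p hp hm
  obtain ⟨⟨lam, hlam⟩, h⟩ := h Y hY q hq
  exact ⟨lam.toSystem, Prod.fst, h lam hlam⟩
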